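/- Let $G$ be a finite group, let $X$ and $Y$ be finite $G$-sets with $Y$ nonempty, let $V=\mathbb R^X$ and $W=\mathbb R^Y$ be the associated permutation representations ($g e_x=e_{gx}$), and let $\sigma:\mathbb R\to\mathbb R$ be continuous and not a polynomial; write $\tilde\sigma$ for $\sigma$ applied entrywise. Let $M=\mathrm{Aff}_G(V,W)$ and $N=\mathrm{Aff}_G(W,\mathbb R)$ be the spaces of $G$-equivariant affine maps ($G$ acting trivially on $\mathbb R$). Let $\mathcal U(M,N)$ be the closure in $\mathcal C(V,\mathbb R)$, for uniform convergence on compact sets, of the set of all networks $x\mapsto\sum_{k=1}^h g_k(\tilde\sigma(f_k(x)))$ with $h\in\mathbb N$, $f_k\in M$, $g_k\in N$. For a family $\mathcal F\subseteq\mathcal C(V,\mathbb R)$ let $\rho(\mathcal F)$ be the set of pairs $(x,y)$ with $f(x)=f(y)$ for all $f\in\mathcal F$; $\mathcal F$ is separation-constrained universal if its closure is the set $\mathcal C_{\rho(\mathcal F)}$ of all continuous $f:V\to\mathbb R$ with $f(x)=f(y)$ for all $(x,y)\in\rho(\mathcal F)$. Let $\ell=|Y|\ge 1$ and identify $Y$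 with $\{1,\dots,\ell\}$. Let $\phi^1,\dots,\phi^m$ be a basis of the linear part $\mathrm{Hom}_G(V,W)$ of $M$, and let $\phi_i:V\to\mathbb R^m$, $\phi_i(x)=(\phi^1_i(x),\dots,\phi^m_i(x))$, $i=1,\dots,\ell$, be its basis maps. Let $i\mapsto\alpha_i\in X$ be a $G$-equivariant map $Y\to X$, i.e. one for which $x\mapsto(e_{\alpha_1}^\top x,\dots,e_{\alpha_\ell}^\top x)$ belongs to $\mathrm{Hom}_G(V,W)$. Let $s_1,\dots,s_\ell\in\{0,\dots,\ell\}$ be integers with $s_1+\dots+s_\ell=\ell$; let $a_1,\dots,a_\ell$ be integers with $a_1>\ell$ and $a_i+\ell<a_{i+1}$ for $1\le i<\ell$; and let $c_i\in V$ with $\phi_i(c_i)=0$ for $i=1,\dots,\ell$. Put $c_{i,j}=e_{\alpha_j}^\top c_i$ and $t_j=s_1+\dots+s_j$ (with $t_0=0$). If $$\sum_{\tau\in S_\ell}\ \Bigl(\prod_{j:\,s_j\ne0}\frac{a_j!}{s_j!}\Bigr)\prod_{j=1}^{\ell}\ \prod_{p=t_{j-1}+1}^{t_j}c_{\tau(p),j}\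 \neq\ 0,$$ then $\mathcal U(M,N)$ is not separation-constrained universal. More precisely, the symmetrized monomial $$F(x)=\sum_{\tau\in S_\ell}\prod_{j=1}^{\ell}\bigl(e_{\alpha_{\tau(j)}}^\top x\bigr)^{a_j}$$ belongs to $\mathcal C_{\rho(\mathcal U(M,N))}$ but not to $\mathcal U(M,N)$. -/

import Mathlib

/-! ### Permutation representations and equivariant layers -/

/-- The permutation representation of `G` on `ℝ^X`, characterised by `g e_x = e_{g x}`
(see `permRep_single`). -/
def permRep (G : Type*) [Group G] (X : Type*) [MulAction G X] :
    Representation ℝ G (X → ℝ) where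
  toFun g := LinearMap.funLeft ℝ ℝ (fun x : X => g⁻¹ • x)
  map_one' := by
    ext v x
    simp [LinearMap.funLeft_apply]
  map_mul' g h := by
    ext v x
    simp [LinearMap.funLeft_apply, mul_smul]

theorem permRep_single {G : Type*} [Group G] {X : Type*} [MulAction G X] [DecidableEq X]
    (g : G) (x : X) :
    permRep G X g (Pi.single x 1) = Pi.single (g • x) 1 := by
  ext z
  simp only [permRep, MonoidHom.coe_mk, OneHom.coe_mk, LinearMap.funLeft_apply, Pi.single_apply,
    inv_smul_eq_iff]

/-- `Aff_G(V, W)`: the affine maps commuting with the action of `G`. -/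
def affG {G V W : Type*} [Group G] [AddCommGroup V] [Module ℝ V] [AddCommGroup W] [Module ℝ W]
    (rV : Representation ℝ G V) (rW : Representation ℝ G W) : Submodule ℝ (V →ᵃ[ℝ] W) where
  carrier := {f | ∀ g v, f (rV g v) = rW g (f v)}
  add_mem' := by
    intro f f' hf hf' g v
    simp [hf g v, hf' g v]
  zero_mem' := by
    intro g v
    simp
  smul_mem' := by
    intro r f hf g v
    simp [hf g v]

/-- The linear part of a space of affine maps. -/
def linearPart {V W : Type*} [AddCommGroup V] [Module ℝ V] [AddCommGroup W] [Module ℝ W]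
    (M : Submodule ℝ (V →ᵃ[ℝ] W)) : Submodule ℝ (V →ₗ[ℝ] W) where
  carrier := {φ | ∃ f ∈ M, f.linear = φ}
  add_mem' := by
    rintro _ _ ⟨f, hf, rfl⟩ ⟨f', hf', rfl⟩
    exact ⟨f + f', M.add_mem hf hf', rfl⟩
  zero_mem' := ⟨0, M.zero_mem, rfl⟩
  smul_mem' := by
    rintro r _ ⟨f, hf, rfl⟩
    exact ⟨r • f, M.smul_mem r hf, rfl⟩

/-- The basis map `φ_y : V → ℝ^m`, `φ_y(v) = (φ^1_y(v), …, φ^m_y(v))`, attached to a basis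
`φ^1, …, φ^m` of the linear part of `M ⊆ Aff(V, ℝ^Y)`. -/
noncomputable def basisMap {V Y : Type*} [AddCommGroup V] [Module ℝ V] {m : ℕ}
    {M : Submodule ℝ (V →ᵃ[ℝ] (Y → ℝ))} (φ : Module.Basis (Fin m) ℝ (linearPart M)) (y : Y) :
    V →ₗ[ℝ] (Fin m → ℝ) :=
  LinearMap.pi fun t => (LinearMap.proj y).comp (φ t : V →ₗ[ℝ] (Y → ℝ))

/-! ### Shallow neural spaces and universality classes -/

/-- `M_h`: the maps `x ↦ (f_1(x), …, f_h(x))` with all `f_k ∈ M`. -/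
def parallelLayer {V W : Type*} [AddCommGroup V] [Module ℝ V] [AddCommGroup W] [Module ℝ W]
    (M : Submodule ℝ (V →ᵃ[ℝ] W)) (h : ℕ) : Set (V →ᵃ[ℝ] (Fin h → W)) :=
  {F | ∃ f : Fin h → (V →ᵃ[ℝ] W), (∀ k, f k ∈ M) ∧ ∀ x k, F x k = f k x}

/-- `_hN`: the maps `(x_1, …, x_h) ↦ g_1(x_1) + ⋯ + g_h(x_h)` with all `g_k ∈ N`. -/
def summedLayer {W Z : Type*} [AddCommGroup W] [Module ℝ W] [AddCommGroup Z] [Module ℝ Z]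
    (N : Submodule ℝ (W →ᵃ[ℝ] Z)) (h : ℕ) : Set ((Fin h → W) →ᵃ[ℝ] Z) :=
  {F | ∃ g : Fin h → (W →ᵃ[ℝ] Z), (∀ k, g k ∈ N) ∧ ∀ w, F w = ∑ k, g k (w k)}

/-- The shallow neural space `N_σ(M_h, _hN)`, where `σ` acts entrywise on
`ℝ^Y ⊗ ℝ^h = (ℝ^Y)^h`. -/
def neuralSpace {V Y Z : Type*} [AddCommGroup V] [Module ℝ V] [TopologicalSpace V]
    [AddCommGroup Z] [Module ℝ Z] [TopologicalSpace Z] (σ : ℝ → ℝ)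
    (M : Submodule ℝ (V →ᵃ[ℝ] (Y → ℝ))) (N : Submodule ℝ ((Y → ℝ) →ᵃ[ℝ] Z)) (h : ℕ) :
    Set C(V, Z) :=
  {η | ∃ f ∈ parallelLayer M h, ∃ g ∈ summedLayer N h,
    ∀ x, η x = g (fun k y => σ (f x k y))}

/-- The universality class `U(M, N)`: the closure, for uniform convergence on compact sets,
of the union over all widths of the shallow neural spaces. -/
def universalityClass {V Y Z : Type*} [AddCommGroup V] [Module ℝ V] [TopologicalSpace V]
    [AddCommGroup Z] [Module ℝ Z] [TopologicalSpace Z] (σ : ℝ → ℝ)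
    (M : Submodule ℝ (V →ᵃ[ℝ] (Y → ℝ))) (N : Submodule ℝ ((Y → ℝ) →ᵃ[ℝ] Z)) :
    Set C(V, Z) :=
  closure (⋃ h : ℕ, neuralSpace σ M N h)

/-! ### Separation -/

/-- `ρ(F)`: the pairs of points that no member of the family `F` separates. -/
def separationRel {A B : Type*} [TopologicalSpace A] [TopologicalSpace B] (F : Set C(A, B)) :
    Set (A × A) :=
  {p | ∀ f ∈ F, f p.1 = f p.2}

/-- `C_ρ(A, B)`: the continuous functions that respect the relation `R`. -/
def respecting {A : Type*} (B : Type*) [TopologicalSpace A] [TopologicalSpace B]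
    (R : Set (A × A)) : Set C(A, B) :=
  {f | ∀ p ∈ R, f p.1 = f p.2}

/-- A family of continuous functions is separation-constrained universal if its closure consists
of all continuous functions that respect its separation relation. -/
def IsSeparationConstrainedUniversal {A B : Type*} [TopologicalSpace A] [TopologicalSpace B]
    (F : Set C(A, B)) : Prop :=
  closure F = respecting B (separationRel F)

/-! ### The combinatorial expression and the symmetrized monomial -/

/-- The `j`-th of the consecutive blocks, of sizes `s_1, s_2, …`, into which the positions
`1, …, ℓ` are cut: the positions `p` with `s_1 + ⋯ + s_{j-1} < p ≤ s_1 + ⋯ + s_j`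
(counted from `1`). -/
def block {ℓ : ℕ} (s : Fin ℓ → ℕ) (j : Fin ℓ) : Finset (Fin ℓ) :=
  Finset.univ.filter fun p =>
    (∑ k ∈ Finset.Iio j, s k) ≤ (p : ℕ) ∧ (p : ℕ) < ∑ k ∈ Finset.Iic j, s k

/-- The sum over all permutations `τ` of
`∏_{s_j ≠ 0} (a_j! / s_j!) · ∏_j ∏_{p in the j-th block} C_{τ(p), j}`. -/
noncomputable def combinatorialSum {ℓ : ℕ} (s a : Fin ℓ → ℕ) (C : Fin ℓ → Fin ℓ → ℝ) : ℝ :=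
  ∑ τ : Equiv.Perm (Fin ℓ),
    (∏ j ∈ Finset.univ.filter (fun j => s j ≠ 0),
      ((a j).factorial : ℝ) / ((s j).factorial : ℝ)) *
    ∏ j, ∏ p ∈ block s j, C (τ p) j

/-- The symmetrized monomial `x ↦ ∑_τ ∏_j (x_{α_{τ(j)}})^{a_j}` on `ℝ^X`. -/
def symmetrizedMonomial {X : Type*} {ℓ : ℕ} (α : Fin ℓ → X) (a : Fin ℓ → ℕ) :
    C(X → ℝ, ℝ) where
  toFun x := ∑ τ : Equiv.Perm (Fin ℓ), ∏ j, x (α (τ j)) ^ a j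
  continuous_toFun := by fun_prop

/-! ### Power sums and non-polynomial activation functions -/

/-! Membership in `respecting`: the width-one networks `∑ y, σ (r * x (α y) + b)` cannot separate a
pair in the relation. If some power sum of the two families `x (α y)`, `x' (α y)` differed, this
identity in `r`, `b` would force `σ` to be a polynomial. So the families agree up to a permutation,
and the symmetrized monomial F is symmetric in them.

Non-membership: a network is a sum of terms each seeing one coordinate `f x y`, which is invariant
under translation by multiples of `c_y`. Hence every product of differences along `r_1 c_1, …, r_ℓ
c_ℓ` kills the class, closure included. If F were in the class, letting the `r_i` tend to 0 would
make the product of the directional derivatives along the `c_i` kill F. Each variable occurring in F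
divides it at least `ℓ` times, and each `c_i` is nonzero in such a variable, so the derivatives can
be cancelled one by one, giving F = 0. But F is `ℓ!` at the all-ones point. The combinatorial sum
enters only to supply the nonzero coordinate of each `c_i`. -/

theorem exists_perm_of_sum_eval_eq {ι : Type*} [Fintype ι] (t u : ι → ℝ)
    (h : ∀ p : Polynomial ℝ, ∑ i, p.eval (t i) = ∑ i, p.eval (u i)) :
    ∃ π : Equiv.Perm ι, ∀ i, u (π i) = t i := by
  classical
  have key : ∀ v : ℝ, Fintype.card {i // t i = v} = Fintype.card {i // u i = v} := by
    intro v
    set S : Finset ℝ := (Finset.univ.image t ∪ Finset.univ.image u).erase v with hS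
    -- `p` vanishes at every value taken except `v`, so summing it counts the fibre over `v`.
    set p : Polynomial ℝ := ∏ r ∈ S, (Polynomial.X - Polynomial.C r) with hp
    have hv : p.eval v ≠ 0 := by
      rw [hp, Polynomial.eval_prod, Finset.prod_ne_zero_iff]
      intro r hr
      simpa [sub_ne_zero] using (Finset.ne_of_mem_erase hr).symm
    have hz : ∀ r ∈ S, p.eval r = 0 := by
      intro r hr
      rw [hp, Polynomial.eval_prod]
      exact Finset.prod_eq_zero hr (by simp)
    have hsum : ∀ w : ι → ℝ, (∀ i, w i ≠ v → w i ∈ S) →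
        ∑ i, p.eval (w i) = Fintype.card {i // w i = v} * p.eval v := by
      intro w hw
      rw [Fintype.card_subtype, ← nsmul_eq_mul, ← Finset.sum_const, Finset.sum_filter]
      refine Finset.sum_congr rfl fun i _ => ?_
      split_ifs with hi
      · rw [hi]
      · exact hz _ (hw i hi)
    have h1 := hsum t fun i hi => by simp [hS, hi]
    have h2 := hsum u fun i hi => by simp [hS, hi]
    have := h p
    rw [h1, h2] at this
    exact_mod_cast mul_right_cancel₀ hv this
  exact ⟨Equiv.ofFiberEquiv fun v => Fintype.equivOfCardEq (key v),
    fun i => Equiv.ofFiberEquiv_map _ i⟩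

theorem Polynomial.exists_derivative_eq {n : ℕ} (p : Polynomial ℝ)
    (hp : p ∈ Polynomial.degreeLT ℝ n) :
    ∃ q ∈ Polynomial.degreeLT ℝ (n + 1), q.derivative = p := by
  refine ⟨∑ i ∈ Finset.range n, Polynomial.monomial (i + 1) (p.coeff i / (i + 1)), ?_, ?_⟩
  · refine Submodule.sum_mem _ fun i hi => ?_
    rw [Polynomial.mem_degreeLT]
    refine (Polynomial.degree_monomial_le _ _).trans_lt ?_
    exact_mod_cast Nat.succ_lt_succ (Finset.mem_range.1 hi)
  · ext k
    simp only [Polynomial.derivative_sum, Polynomial.derivative_monomial,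
      Polynomial.finsetSum_coeff, Polynomial.coeff_monomial, Nat.add_sub_cancel]
    rw [Finset.sum_ite_eq' (Finset.range n) k]
    split_ifs with hk
    · push_cast
      field_simp
    · rw [Finset.mem_range, not_lt] at hk
      exact (Polynomial.coeff_eq_zero_of_degree_lt
        ((Polynomial.mem_degreeLT.1 hp).trans_le (by exact_mod_cast hk))).symm

/-- A smooth function that satisfies a linear relation between its dilates and translates is a
polynomial, whose degree is bounded by the order of a non-vanishing moment of the relation. -/
theorem exists_polynomial_of_ridge_relation {ι : Type*} [Fintype ι] (t : ι → ℝ) (k : ℕ) :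
    ∀ (w : ι → ℝ) (f : ℝ → ℝ), ContDiff ℝ (⊤ : ℕ∞) f →
      (∀ r b, ∑ i, w i * f (r * t i + b) = 0) → ∑ i, w i * t i ^ k ≠ 0 →
      ∃ p ∈ Polynomial.degreeLT ℝ k, ∀ x, f x = p.eval x := by
  induction k with
  | zero =>
    intro w f _ hf hw
    refine ⟨0, Submodule.zero_mem _, fun x => ?_⟩
    have h := hf 0 x
    simp only [zero_mul, zero_add, ← Finset.sum_mul] at h
    simpa using (mul_eq_zero.1 h).resolve_left (by simpa using hw)
  | succ k ih =>
    intro w f hs hf hw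
    have hdiff : Differentiable ℝ f := hs.differentiable (by simp)
    -- Differentiating the relation in `r` multiplies the weights by `t i`, which shifts the moments
    -- by one.
    obtain ⟨p, hp, hfp⟩ := ih (fun i => w i * t i) (deriv f)
      ((contDiff_infty_iff_deriv.1 hs).2) (by
        intro r b
        have h1 : HasDerivAt (fun r => ∑ i, w i * f (r * t i + b))
            (∑ i, w i * (deriv f (r * t i + b) * t i)) r := by
          refine HasDerivAt.fun_sum fun i _ => HasDerivAt.const_mul _ ?_
          have h2 : HasDerivAt (fun r => r * t i + b) (t i) r := by
            simpa using ((hasDerivAt_id r).mul_const (t i)).add_const b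
          exact (hdiff (r * t i + b)).hasDerivAt.comp r h2
        have h3 : HasDerivAt (fun r => ∑ i, w i * f (r * t i + b)) 0 r := by
          simp only [hf]
          exact hasDerivAt_const r 0
        rw [← h1.unique h3]
        exact Finset.sum_congr rfl fun i _ => by ring) (by
        simpa only [pow_succ', mul_assoc] using hw)
    obtain ⟨q, hq, rfl⟩ := Polynomial.exists_derivative_eq p hp
    refine ⟨q + Polynomial.C (f 0 - q.eval 0), Submodule.add_mem _ hq ?_, fun x => ?_⟩
    · rw [Polynomial.mem_degreeLT]
      exact Polynomial.degree_C_le.trans_lt (by exact_mod_cast Nat.succ_pos k)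
    · have hd : Differentiable ℝ fun x => f x - q.eval x := hdiff.sub q.differentiable
      have := is_const_of_deriv_eq_zero hd (fun x => by
        rw [deriv_fun_sub (hdiff x) q.differentiableAt, hfp, Polynomial.deriv, sub_self]) x 0
      simp only [Polynomial.eval_add, Polynomial.eval_C]
      linarith

open Filter Topology in
/-- A continuous function that satisfies a linear relation with a non-vanishing moment between
its dilates and translates is a polynomial. -/
theorem exists_polynomial_of_ridge_relation_of_continuous {ι : Type*} [Fintype ι] (t w : ι → ℝ)
    (k : ℕ) (f : ℝ → ℝ) (hf : Continuous f) (hrel : ∀ r b, ∑ i, w i * f (r * t i + b) = 0)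
    (hw : ∑ i, w i * t i ^ k ≠ 0) : ∃ p : Polynomial ℝ, ∀ x, f x = p.eval x := by
  let ev : Polynomial ℝ →ₗ[ℝ] (ℝ → ℝ) := LinearMap.pi fun x => Polynomial.leval x
  -- The degree bound `k` is the same for all mollifications of `f`, so they lie in one
  -- finite-dimensional, hence pointwise closed, space.
  let S : Submodule ℝ (ℝ → ℝ) := (Polynomial.degreeLT ℝ k).map ev
  have : FiniteDimensional ℝ (Polynomial.degreeLT ℝ k) :=
    (Polynomial.degreeLTEquiv ℝ k).symm.finiteDimensional
  have hS : IsClosed (S : Set (ℝ → ℝ)) := S.closed_of_finiteDimensional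
  let φ : ℕ → ContDiffBump (0 : ℝ) := fun n =>
    ⟨1 / ((n : ℝ) + 1) / 2, 1 / ((n : ℝ) + 1), by positivity, by
      have : 0 < 1 / ((n : ℝ) + 1) := by positivity
      linarith⟩
  let F : ℕ → ℝ → ℝ := fun n =>
    MeasureTheory.convolution ((φ n).normed MeasureTheory.volume) f
      (ContinuousLinearMap.lsmul ℝ ℝ) MeasureTheory.volume
  have hlim : Tendsto F atTop (𝓝 f) := by
    rw [tendsto_pi_nhds]
    intro x
    exact ContDiffBump.convolution_tendsto_right_of_continuous
      tendsto_one_div_add_atTop_nhds_zero_nat hf x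
  have hF : ∀ n, F n ∈ S := by
    intro n
    have hex := (φ n).hasCompactSupport_normed (μ := MeasureTheory.volume)
      |>.convolutionExists_left (ContinuousLinearMap.lsmul ℝ ℝ)
      (μ := MeasureTheory.volume) (φ n).continuous_normed hf.locallyIntegrable
    obtain ⟨p, hp, hpF⟩ := exists_polynomial_of_ridge_relation t k w (F n)
      ((φ n).hasCompactSupport_normed.contDiff_convolution_left _ (φ n).contDiff_normed
        hf.locallyIntegrable)
      (fun r b => by
        have h1 : ∀ i, w i * F n (r * t i + b) = ∫ s,
            w i * ((φ n).normed MeasureTheory.volume s * f (r * t i + b - s)) := by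
          intro i
          rw [MeasureTheory.integral_const_mul]
          rfl
        simp_rw [h1]
        rw [← MeasureTheory.integral_finsetSum]
        · have h2 : ∀ s, ∑ i, w i * ((φ n).normed MeasureTheory.volume s *
              f (r * t i + b - s)) = 0 := by
            intro s
            have := hrel r (b - s)
            calc _ = (φ n).normed MeasureTheory.volume s *
                ∑ i, w i * f (r * t i + (b - s)) := by
                  rw [Finset.mul_sum]
                  refine Finset.sum_congr rfl fun i _ => ?_
                  rw [add_sub_assoc]
                  ring
              _ = 0 := by rw [this, mul_zero]
          simp_rw [h2]
          simp
        · intro i _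
          exact (hex (r * t i + b)).const_mul (w i)) hw
    exact ⟨p, hp, funext fun x => (hpF x).symm⟩
  obtain ⟨p, -, hp⟩ := hS.mem_of_tendsto hlim (Eventually.of_forall hF)
  exact ⟨p, fun x => (congrFun hp x).symm⟩

theorem exists_perm_of_sum_ridge_eq {ι : Type*} [Fintype ι] (t u : ι → ℝ) (f : ℝ → ℝ)
    (hf : Continuous f) (hpoly : ¬ ∃ p : Polynomial ℝ, ∀ x, f x = p.eval x)
    (h : ∀ r b, ∑ i, f (r * t i + b) = ∑ i, f (r * u i + b)) :
    ∃ π : Equiv.Perm ι, ∀ i, u (π i) = t i := by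
  have hpow : ∀ k : ℕ, ∑ i, t i ^ k = ∑ i, u i ^ k := by
    intro k
    by_contra hk
    -- With weights `1` on `t` and `-1` on `u`, the `k`-th moment is the difference of the power
    -- sums.
    refine hpoly (exists_polynomial_of_ridge_relation_of_continuous (Sum.elim t u)
      (Sum.elim (fun _ => 1) (fun _ => -1)) k f hf (fun r b => ?_) ?_)
    · simp [h r b]
    · simpa [← sub_eq_add_neg, sub_ne_zero] using hk
  refine exists_perm_of_sum_eval_eq t u fun p => ?_
  simp_rw [Polynomial.eval_eq_sum_range]
  rw [Finset.sum_comm, Finset.sum_comm (s := Finset.univ)]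
  refine Finset.sum_congr rfl fun k _ => ?_
  rw [← Finset.mul_sum, ← Finset.mul_sum, hpow]

/-! ### Iterated finite differences -/

/-- The iterated difference `Δ_{v_1} ⋯ Δ_{v_n} f` along a list of vectors. -/
def iteratedDifference {V : Type*} [AddCommGroup V] : List V → (V → ℝ) → V → ℝ
  | [], f => f
  | v :: L, f => iteratedDifference L fun x => f (x + v) - f x

section IteratedDifference

variable {V : Type*} [AddCommGroup V]

/-- Differences commute: the definition applies the head first, this form applies it last. -/
theorem iteratedDifference_cons (v : V) (L : List V) (f : V → ℝ) (x : V) :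
    iteratedDifference (v :: L) f x =
      iteratedDifference L f (x + v) - iteratedDifference L f x := by
  induction L generalizing f with
  | nil => rfl
  | cons u L ih =>
    simp only [iteratedDifference] at ih ⊢
    rw [← ih]
    congr 1
    funext y
    rw [add_right_comm y u v]
    ring

theorem iteratedDifference_sum {ι : Type*} (S : Finset ι) (L : List V) (f : ι → V → ℝ) (x : V) :
    iteratedDifference L (fun x => ∑ i ∈ S, f i x) x = ∑ i ∈ S, iteratedDifference L (f i) x := by
  induction L generalizing f with
  | nil => rfl
  | cons v L ih =>
    simp only [iteratedDifference]
    rw [← ih]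
    simp only [Finset.sum_sub_distrib]

theorem iteratedDifference_zero (L : List V) (x : V) :
    iteratedDifference L (fun _ => 0) x = 0 := by
  simpa using iteratedDifference_sum ∅ L (fun (_ : Empty) _ => 0) x

theorem iteratedDifference_eq_zero_of_invariant {L : List V} {v : V} (hv : v ∈ L) {f : V → ℝ}
    (hf : ∀ x, f (x + v) = f x) (x : V) : iteratedDifference L f x = 0 := by
  induction L generalizing f with
  | nil => simp at hv
  | cons u L ih =>
    rw [iteratedDifference]
    rcases List.mem_cons.1 hv with rfl | hv
    · simp only [hf, sub_self]
      exact iteratedDifference_zero L x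
    · refine ih hv fun x => ?_
      rw [add_right_comm, hf, hf]

theorem continuous_iteratedDifference {T : Type*} [TopologicalSpace T] (L : List V)
    (f : T → V → ℝ) (hf : ∀ x, Continuous fun t => f t x) (x : V) :
    Continuous fun t => iteratedDifference L (f t) x := by
  induction L generalizing f with
  | nil => exact hf x
  | cons v L ih => exact ih _ fun x => (hf _).sub (hf _)

theorem hasDerivAt_iteratedDifference [Module ℝ V] (L : List V) (v : V) (f f' : V → ℝ)
    (h : ∀ x, HasDerivAt (fun r : ℝ => f (x + r • v)) (f' x) 0) (x : V) :
    HasDerivAt (fun r : ℝ => iteratedDifference L f (x + r • v)) (iteratedDifference L f' x) 0 := by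
  induction L generalizing f f' with
  | nil => exact h x
  | cons u L ih =>
    refine ih _ _ fun x => ?_
    have := (h (x + u)).fun_sub (h x)
    simpa only [add_right_comm x u] using this

end IteratedDifference

/-! ### Directional derivatives of multivariate polynomials -/

/-- The derivative of a polynomial in the constant direction `c`. -/
noncomputable def dirDeriv {X : Type*} (c : X → ℝ) :
    Derivation ℝ (MvPolynomial X ℝ) (MvPolynomial X ℝ) :=
  MvPolynomial.mkDerivation ℝ fun x => MvPolynomial.C (c x)

section DirDeriv

variable {X : Type*}

theorem hasDerivAt_eval_add_smul (c : X → ℝ) (p : MvPolynomial X ℝ) (x : X → ℝ) (r : ℝ) :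
    HasDerivAt (fun r : ℝ => MvPolynomial.eval (x + r • c) p)
      (MvPolynomial.eval (x + r • c) (dirDeriv c p)) r := by
  induction p using MvPolynomial.induction_on with
  | C b => simpa [dirDeriv] using hasDerivAt_const r b
  | add p q hp hq => simpa using hp.fun_add hq
  | mul_X p i hp =>
    have hi : HasDerivAt (fun r : ℝ => x i + r * c i) (c i) r := by
      simpa using ((hasDerivAt_id r).mul_const (c i)).const_add (x i)
    have := hp.fun_mul hi
    simp only [map_mul, MvPolynomial.eval_X, Pi.add_apply, Pi.smul_apply, smul_eq_mul,
      Derivation.leibniz, dirDeriv, MvPolynomial.mkDerivation_X, map_add, MvPolynomial.eval_C]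
        at this ⊢
    refine this.congr_deriv ?_
    ring

theorem X_pow_dvd_dirDeriv (c : X → ℝ) {p : MvPolynomial X ℝ} {i : X} {k : ℕ}
    (h : MvPolynomial.X i ^ (k + 1) ∣ p) : MvPolynomial.X i ^ k ∣ dirDeriv c p := by
  obtain ⟨q, rfl⟩ := h
  rw [Derivation.leibniz, Derivation.leibniz_pow]
  refine dvd_add ?_ ?_
  · exact (pow_dvd_pow _ (Nat.le_succ k)).mul_right _
  · simp only [Nat.add_sub_cancel, smul_eq_mul]
    rw [nsmul_eq_mul]
    exact (((dvd_refl _).mul_right _).mul_left _).mul_left _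

/-- Constant along lines in direction `c`, and each such line meets the hyperplane `x i = 0`, where
`p` vanishes. -/
theorem eq_zero_of_dirDeriv_eq_zero {c : X → ℝ} {p : MvPolynomial X ℝ} {i : X} (hi : c i ≠ 0)
    (hp : MvPolynomial.X i ∣ p) (h : dirDeriv c p = 0) : p = 0 := by
  refine MvPolynomial.funext fun x => ?_
  have hconst := is_const_of_deriv_eq_zero
    (fun r => (hasDerivAt_eval_add_smul c p x r).differentiableAt)
    (fun r => by rw [(hasDerivAt_eval_add_smul c p x r).deriv, h, map_zero]) 0 (-(x i / c i))
  obtain ⟨q, rfl⟩ := hp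
  simp only [zero_smul, add_zero] at hconst
  rw [hconst]
  simp [hi]

/-- A polynomial that is divisible by a power of each variable exceeding the number of directions
vanishes as soon as its iterated differences along all multiples of these directions do. -/
theorem eq_zero_of_iteratedDifference_eq_zero (L : List (X → ℝ)) (p : MvPolynomial X ℝ)
    (A : Set X) (hA : ∀ i ∈ A, MvPolynomial.X i ^ L.length ∣ p)
    (hL : ∀ c ∈ L, ∃ i ∈ A, c i ≠ 0)
    (h : ∀ L' : List (X → ℝ), List.Forall₂ (fun c c' => ∃ r : ℝ, c' = r • c) L L' →
      ∀ x, iteratedDifference L' (fun x => MvPolynomial.eval x p) x = 0) : p = 0 := by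
  induction L generalizing p with
  | nil => exact MvPolynomial.funext fun x => by simpa [iteratedDifference] using h [] .nil x
  | cons c L ih =>
    obtain ⟨i, hiA, hi⟩ := hL c List.mem_cons_self
    refine eq_zero_of_dirDeriv_eq_zero hi ((dvd_pow_self _ (by simp)).trans (hA i hiA)) ?_
    refine ih _ (fun j hj => X_pow_dvd_dirDeriv c (hA j hj))
      (fun c' hc' => hL c' (List.mem_cons_of_mem _ hc')) fun L' hL' x => ?_
    have h1 := hasDerivAt_iteratedDifference L' c (fun x => MvPolynomial.eval x p)
      (fun x => MvPolynomial.eval x (dirDeriv c p))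
      (fun x => by simpa using hasDerivAt_eval_add_smul c p x 0) x
    -- Constancy in `r` makes the derivative at 0 vanish; by `h1` that derivative is the iterated
    -- difference of `dirDeriv c p`.
    have h2 : ∀ r : ℝ, iteratedDifference L' (fun x => MvPolynomial.eval x p) (x + r • c) =
        iteratedDifference L' (fun x => MvPolynomial.eval x p) x := by
      intro r
      have := h ((r • c) :: L') (.cons ⟨r, rfl⟩ hL') x
      rwa [iteratedDifference_cons, sub_eq_zero] at this
    simp only [h2] at h1
    exact h1.unique (hasDerivAt_const _ _)

end DirDeriv

/-! ### Networks -/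

/-- The functional `f ↦ f.linear c y` vanishes on the basis, hence on the whole linear part. -/
theorem apply_add_of_mem_ker_basisMap {V Y : Type*} [AddCommGroup V] [Module ℝ V] {m : ℕ}
    {M : Submodule ℝ (V →ᵃ[ℝ] (Y → ℝ))} (φ : Module.Basis (Fin m) ℝ (linearPart M)) {y : Y}
    {c : V} (hc : c ∈ LinearMap.ker (basisMap φ y)) {f : V →ᵃ[ℝ] (Y → ℝ)} (hf : f ∈ M) (x : V) :
    f (x + c) y = f x y := by
  have h0 : ∀ t, (φ t : V →ₗ[ℝ] (Y → ℝ)) c y = 0 := fun t =>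
    congrFun (LinearMap.mem_ker.1 hc) t
  let ψ : linearPart M →ₗ[ℝ] ℝ :=
    (LinearMap.proj y).comp ((LinearMap.applyₗ c).comp (linearPart M).subtype)
  have hψ : ψ = 0 := φ.ext fun t => by simpa [ψ] using h0 t
  have h1 : f.linear c y = 0 := LinearMap.congr_fun hψ ⟨f.linear, f, hf, rfl⟩
  have h2 := f.map_vadd x c
  rw [vadd_eq_add, vadd_eq_add, add_comm c x] at h2
  rw [h2, Pi.add_apply, h1, zero_add]

theorem iteratedDifference_eq_zero_of_mem_universalityClass {V Y : Type*} [AddCommGroup V]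
    [Module ℝ V] [TopologicalSpace V] [Finite Y] [Nonempty Y] {σ : ℝ → ℝ}
    {M : Submodule ℝ (V →ᵃ[ℝ] (Y → ℝ))} {N : Submodule ℝ ((Y → ℝ) →ᵃ[ℝ] ℝ)} {L : List V}
    (hL : ∀ y, ∃ v ∈ L, ∀ f ∈ M, ∀ x, f (x + v) y = f x y) {η : C(V, ℝ)}
    (hη : η ∈ universalityClass σ M N) (x : V) : iteratedDifference L η x = 0 := by
  classical
  have := Fintype.ofFinite Y
  have hclosed : IsClosed {η : C(V, ℝ) | iteratedDifference L η x = 0} :=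
    isClosed_eq (continuous_iteratedDifference L _ (fun x => continuous_eval_const x) x)
      continuous_const
  refine closure_minimal ?_ hclosed hη
  intro η hη
  obtain ⟨h, F, ⟨f, hf, hF⟩, g, ⟨gs, -, hg⟩, hη⟩ := Set.mem_iUnion.1 hη
  have hlin : ∀ k w, gs k w = gs k 0 + ∑ y, w y * (gs k).linear (Pi.single y 1) := by
    intro k w
    have h1 := (gs k).map_vadd 0 w
    rw [vadd_eq_add, vadd_eq_add, add_zero] at h1
    rw [h1, add_comm, LinearMap.pi_apply_eq_sum_univ (gs k).linear w]
    refine congrArg _ (Finset.sum_congr rfl fun y _ => ?_)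
    rw [smul_eq_mul]
    congr 2
    funext z
    simp [Pi.single_apply, eq_comm]
  -- `none` carries the constant term of `gs k`, and `some y` the term that sees only coordinate
  -- `y`.
  have hform : (η : V → ℝ) = fun x => ∑ i : Fin h × Option Y,
      i.2.elim (gs i.1 0) fun y => σ (f i.1 x y) * (gs i.1).linear (Pi.single y 1) := by
    funext x
    rw [hη, hg, Fintype.sum_prod_type]
    refine Finset.sum_congr rfl fun k _ => ?_
    rw [hlin, Fintype.sum_option]
    simp [hF]
  simp only [Set.mem_ofPred_eq, hform]
  rw [iteratedDifference_sum]
  refine Finset.sum_eq_zero fun i _ => ?_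
  obtain ⟨k, _ | y⟩ := i
  · obtain ⟨v, hv, -⟩ := hL (Classical.arbitrary Y)
    exact iteratedDifference_eq_zero_of_invariant hv (fun x => rfl) x
  · obtain ⟨v, hv, hfv⟩ := hL y
    exact iteratedDifference_eq_zero_of_invariant hv (fun x => by simp [hfv _ (hf k)]) x

section Separation

variable {G X Y : Type*} [Group G] [MulAction G X] [MulAction G Y]

/-- The equivariant affine map `x ↦ (r x_{α y} + b)_y` attached to an equivariant map `α`. -/
def pullbackAffine (α : Y →[G] X) (r b : ℝ) : (X → ℝ) →ᵃ[ℝ] (Y → ℝ) :=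
  (r • LinearMap.funLeft ℝ ℝ α).toAffineMap + AffineMap.const ℝ (X → ℝ) fun _ => b

theorem pullbackAffine_apply (α : Y →[G] X) (r b : ℝ) (x : X → ℝ) (y : Y) :
    pullbackAffine α r b x y = r * x (α y) + b := by
  simp [pullbackAffine, LinearMap.funLeft_apply]

theorem pullbackAffine_mem_affG (α : Y →[G] X) (r b : ℝ) :
    pullbackAffine α r b ∈ affG (permRep G X) (permRep G Y) := by
  intro g v
  funext y
  simp [permRep, pullbackAffine_apply, LinearMap.funLeft_apply]

/-- The sum of all coordinates. -/
def coordSum (Y : Type*) [Fintype Y] : (Y → ℝ) →ₗ[ℝ] ℝ := ∑ y, LinearMap.proj y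

theorem coordSum_mem_affG [Fintype Y] :
    (coordSum Y).toAffineMap ∈ affG (permRep G Y) (Representation.trivial ℝ G ℝ) := by
  intro g v
  simpa [coordSum, permRep, LinearMap.funLeft_apply] using
    Equiv.sum_comp (MulAction.toPerm g⁻¹) v

theorem sum_ridge_eq_of_mem_separationRel [Fintype Y] {σ : ℝ → ℝ} (hσ : Continuous σ)
    (α : Y →[G] X) {x x' : X → ℝ}
    (h : (x, x') ∈ separationRel (universalityClass σ (affG (permRep G X) (permRep G Y))
      (affG (permRep G Y) (Representation.trivial ℝ G ℝ)))) (r b : ℝ) :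
    ∑ y, σ (r * x (α y) + b) = ∑ y, σ (r * x' (α y) + b) := by
  let η : C(X → ℝ, ℝ) := ⟨fun x => ∑ y, σ (r * x (α y) + b), by fun_prop⟩
  refine h η (subset_closure (Set.mem_iUnion.2 ⟨1, ?_⟩))
  refine ⟨AffineMap.pi fun _ => pullbackAffine α r b,
    ⟨fun _ => _, fun _ => pullbackAffine_mem_affG α r b, fun _ _ => rfl⟩,
    ((coordSum Y).comp (LinearMap.proj 0)).toAffineMap,
    ⟨fun _ => (coordSum Y).toAffineMap, fun _ => coordSum_mem_affG, fun w => by simp⟩, fun x => ?_⟩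
  simp [η, coordSum, pullbackAffine_apply]

end Separation

/-! ### The symmetrized monomial -/

theorem symmetrizedMonomial_eq_of_perm {X : Type*} {ℓ : ℕ} (α : Fin ℓ → X) (a : Fin ℓ → ℕ)
    {x x' : X → ℝ} (π : Equiv.Perm (Fin ℓ)) (h : ∀ i, x' (α (π i)) = x (α i)) :
    symmetrizedMonomial α a x = symmetrizedMonomial α a x' := by
  simp only [symmetrizedMonomial, ContinuousMap.coe_mk]
  rw [← Equiv.sum_comp (Equiv.mulLeft π) fun τ => ∏ j, x' (α (τ j)) ^ a j]
  simp [h]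

/-- In a nonzero summand `τ`, the position `τ⁻¹ i` lies in some block `j`, because the blocks cover
all positions; so `C i j` is a nonzero factor. -/
theorem exists_ne_zero_of_combinatorialSum_ne_zero {ℓ : ℕ} {s a : Fin ℓ → ℕ}
    (hs : ∑ j, s j = ℓ) {C : Fin ℓ → Fin ℓ → ℝ} (h : combinatorialSum s a C ≠ 0) (i : Fin ℓ) :
    ∃ j, C i j ≠ 0 := by
  obtain ⟨τ, -, hτ⟩ := Finset.exists_ne_zero_of_sum_ne_zero h
  have hτ := right_ne_zero_of_mul hτ
  set p := τ.symm i with hp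
  let t : ℕ → ℕ := fun n => ∑ k ∈ Finset.univ.filter fun k : Fin ℓ => (k : ℕ) < n, s k
  -- The least such `n` is one more than the 0-based index of the block containing `p`.
  have hex : ∃ n, (p : ℕ) < t n := ⟨ℓ, by simp [t, hs]⟩
  have hpos : Nat.find hex ≠ 0 := by
    intro h0
    have := Nat.find_spec hex
    simp [h0, t] at this
  obtain ⟨n, hn⟩ := Nat.exists_eq_succ_of_ne_zero hpos
  have hlt : (p : ℕ) < t (n + 1) := by
    have := Nat.find_spec hex
    rwa [hn] at this
  have hle : t n ≤ p := not_lt.1 (Nat.find_min hex (by omega))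
  have hnℓ : n < ℓ := by
    by_contra hcon
    have hall : t n = ℓ := by
      rw [← hs]
      simp only [t]
      rw [Finset.filter_true_of_mem fun k _ => k.isLt.trans_le (not_lt.1 hcon)]
    have := p.isLt
    omega
  refine ⟨⟨n, hnℓ⟩, ?_⟩
  have hmem : p ∈ block s ⟨n, hnℓ⟩ := by
    rw [block, Finset.mem_filter]
    refine ⟨Finset.mem_univ _, ?_, ?_⟩
    · convert hle using 2
      ext k
      simp [Fin.lt_def]
    · convert hlt using 2
      ext k
      simp [Fin.le_def]
  have := Finset.prod_ne_zero_iff.1 (Finset.prod_ne_zero_iff.1 hτ ⟨n, hnℓ⟩ (Finset.mem_univ _))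
    p hmem
  simpa [hp] using this

theorem symmetrizedMonomial_not_mem_universalityClass {X Y : Type*} [Finite Y] {σ : ℝ → ℝ}
    {ℓ m : ℕ} (hℓ : 0 < ℓ) (e : Fin ℓ ≃ Y) {M : Submodule ℝ ((X → ℝ) →ᵃ[ℝ] (Y → ℝ))}
    {N : Submodule ℝ ((Y → ℝ) →ᵃ[ℝ] ℝ)} (φ : Module.Basis (Fin m) ℝ (linearPart M))
    (α : Fin ℓ → X) (a : Fin ℓ → ℕ) (ha : ∀ j, ℓ ≤ a j) (c : Fin ℓ → X → ℝ)
    (hc : ∀ i, c i ∈ LinearMap.ker (basisMap φ (e i))) (hne : ∀ i, ∃ j, c i (α j) ≠ 0) :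
    symmetrizedMonomial α a ∉ universalityClass σ M N := by
  intro hmem
  have : Nonempty Y := ⟨e ⟨0, hℓ⟩⟩
  let p : MvPolynomial X ℝ :=
    ∑ τ : Equiv.Perm (Fin ℓ), ∏ j, MvPolynomial.X (α (τ j)) ^ a j
  have hp : ∀ x, MvPolynomial.eval x p = symmetrizedMonomial α a x := by
    intro x
    simp [p, symmetrizedMonomial, map_sum, map_prod]
  have hp0 : p = 0 := by
    refine eq_zero_of_iteratedDifference_eq_zero (List.ofFn c) p (Set.range α) ?_ ?_ ?_
    · rintro _ ⟨i, rfl⟩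
      rw [List.length_ofFn]
      refine Finset.dvd_sum fun τ _ => ?_
      -- In the summand `τ`, the variable at `α i` occurs in the factor `τ.symm i`.
      refine dvd_trans ?_ (Finset.dvd_prod_of_mem _ (Finset.mem_univ (τ.symm i)))
      rw [Equiv.apply_symm_apply]
      exact pow_dvd_pow _ (ha _)
    · intro v hv
      obtain ⟨i, rfl⟩ := (List.mem_ofFn' _ _).1 hv
      obtain ⟨j, hj⟩ := hne i
      exact ⟨α j, ⟨j, rfl⟩, hj⟩
    · intro L' hL' x
      simp_rw [hp]
      refine iteratedDifference_eq_zero_of_mem_universalityClass (fun y => ?_) hmem x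
      have hlen := hL'.length_eq
      rw [List.length_ofFn] at hlen
      obtain ⟨r, hr⟩ := hL'.get (i := e.symm y) (by simp) (by rw [← hlen]; exact (e.symm y).isLt)
      refine ⟨_, List.get_mem L' ⟨e.symm y, by rw [← hlen]; exact (e.symm y).isLt⟩, fun f hf x => ?_⟩
      rw [hr]
      refine apply_add_of_mem_ker_basisMap φ (Submodule.smul_mem _ r ?_) hf x
      simpa using hc (e.symm y)
  have h1 := hp fun _ => 1
  rw [hp0] at h1
  simp only [symmetrizedMonomial, map_zero, ContinuousMap.coe_mk, one_pow, Finset.prod_const_one,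
    Finset.sum_const, Finset.card_univ, nsmul_eq_mul, mul_one] at h1
  exact Fintype.card_ne_zero (by exact_mod_cast h1.symm)

theorem mainTheorem4
    {G : Type*} [Group G] [Finite G]
    {X : Type*} [Finite X] [MulAction G X]
    {Y : Type*} [Finite Y] [MulAction G Y]
    -- a continuous, non-polynomial activation function
    (σ : ℝ → ℝ) (hσ : Continuous σ)
    (hσ_poly : ¬ ∃ p : Polynomial ℝ, ∀ t, σ t = p.eval t)
    -- `Y` is identified with `[ℓ]`
    {ℓ : ℕ} (hℓ : 0 < ℓ) (e : Fin ℓ ≃ Y)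
    -- a basis of the linear part of `M = Aff_G(ℝ^X, ℝ^Y)`
    {m : ℕ} (φ : Module.Basis (Fin m) ℝ (linearPart (affG (permRep G X) (permRep G Y))))
    -- `α_i = α (e i)`; equivariance says that `x ↦ (x_{α_1}, …, x_{α_ℓ})` is in `Hom_G(ℝ^X, ℝ^Y)`
    (α : Y →[G] X)
    (s : Fin ℓ → ℕ) (hs : ∑ j, s j = ℓ)
    (a : Fin ℓ → ℕ) (ha_first : ℓ < a ⟨0, hℓ⟩)
    (ha_gap : ∀ (i : ℕ) (hi : i + 1 < ℓ), a ⟨i, Nat.lt_of_succ_lt hi⟩ + ℓ < a ⟨i + 1, hi⟩)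
    (c : Fin ℓ → X → ℝ) (hc : ∀ i, c i ∈ LinearMap.ker (basisMap φ (e i)))
    (hne : combinatorialSum s a (fun i j => c i (α (e j))) ≠ 0) :
    ¬ IsSeparationConstrainedUniversal
        (universalityClass σ (affG (permRep G X) (permRep G Y))
          (affG (permRep G Y) (Representation.trivial ℝ G ℝ))) ∧
      symmetrizedMonomial (fun i => α (e i)) a ∈
        respecting ℝ (separationRel
          (universalityClass σ (affG (permRep G X) (permRep G Y))
            (affG (permRep G Y) (Representation.trivial ℝ G ℝ)))) ∧
      symmetrizedMonomial (fun i => α (e i)) a ∉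
        universalityClass σ (affG (permRep G X) (permRep G Y))
          (affG (permRep G Y) (Representation.trivial ℝ G ℝ)) := by
  have := Fintype.ofFinite Y
  have ha : ∀ (n : ℕ) (hn : n < ℓ), ℓ ≤ a ⟨n, hn⟩ := by
    intro n
    induction n with
    | zero => exact fun _ => ha_first.le
    | succ n ih =>
      intro hn
      have h1 := ih (Nat.lt_of_succ_lt hn)
      have h2 := ha_gap n hn
      omega
  have hmem : symmetrizedMonomial (fun i => α (e i)) a ∈
      respecting ℝ (separationRel
        (universalityClass σ (affG (permRep G X) (permRep G Y))
          (affG (permRep G Y) (Representation.trivial ℝ G ℝ)))) := by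
    rintro ⟨x, x'⟩ h
    obtain ⟨π, hπ⟩ := exists_perm_of_sum_ridge_eq (fun i => x (α (e i))) (fun i => x' (α (e i)))
      σ hσ hσ_poly fun r b => by
        rw [e.sum_comp fun y => σ (r * x (α y) + b), e.sum_comp fun y => σ (r * x' (α y) + b)]
        exact sum_ridge_eq_of_mem_separationRel hσ α h r b
    exact symmetrizedMonomial_eq_of_perm _ a π hπ
  have hnot : symmetrizedMonomial (fun i => α (e i)) a ∉
      universalityClass σ (affG (permRep G X) (permRep G Y))
        (affG (permRep G Y) (Representation.trivial ℝ G ℝ)) :=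
    symmetrizedMonomial_not_mem_universalityClass hℓ e φ _ a (fun j => ha j j.isLt) c hc
      (exists_ne_zero_of_combinatorialSum_ne_zero hs hne)
  refine ⟨fun huniv => hnot ?_, hmem, hnot⟩
  -- The class is already closed, so universality would put F in it.
  rw [IsSeparationConstrainedUniversal, universalityClass, closure_closure] at huniv
  rw [universalityClass, huniv]
  exact hmem
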